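/- Let $\mathsf{X}$ be a Polish space with its Borel $\sigma$-algebra, let $K$ be a Markov transition kernel on $\mathsf{X}$, and let $\varpi$ be a probability measure on $\mathsf{X}$ with respect to which $K$ is reversible, i.e. $\int_A K(x,B)\,\varpi(\mathrm{d}x)=\int_B K(x,A)\,\varpi(\mathrm{d}x)$ for all measurable $A,B$ (so that $\varpi K=\varpi$). Let $\mathcal{F}'$ be the set of probability measures $\mu\ll\varpi$ with $\int_{\mathsf X}(\mathrm{d}\mu/\mathrm{d}\varpi)^2\,\mathrm{d}\varpi<\infty$, and for $\mu,\nu\in\mathcal{F}'$ let \[ \|\mu-\nu\|_2=\sup\Big\{\Big|\int f\,\mathrm{d}\mu-\int f\,\mathrm{d}\nu\Big| : f:\mathsf{X}\to\mathbb{R}\text{ measurable},\ \int f^2\,\mathrm{d}\varpi=1\Big\}. \] Let $\mu K^t$ denote the law after $t$ steps of the chain started from $\mu$ (so $\mu K^0=\mu$). Let $L^2_0(\varpi)$ be the space of $f\in L^2(\varpi)$ with $\int f\,\mathrm{d}\varpi=0$, and let $\|K\|_2$ be the operator norm of the bounded linear operator $f\mapsto Kf$, $Kf(x)=\int f(x')\,K(x,\mathrm{d}x')$,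 on $L^2_0(\varpi)$ with the $L^2(\varpi)$ norm. Suppose that there exist a function $C:\mathcal{F}'\to[0,\infty)$ and a constant $\rho\in[0,1)$ such that \[ \|\mu K^t-\varpi\|_2\le C(\mu)\,\rho^t\qquad\text{for all }\mu\in\mathcal{F}'\text{ and all integers }t\ge 0 . \] Then $\|K\|_2\le\rho$. -/

import Mathlib

open MeasureTheory ProbabilityTheory
open scoped ENNReal NNReal

namespace MarkovL2

variable {X : Type*} [MeasurableSpace X]

/-- The class of initial laws: probability measures `μ ≪ π` whose density `dμ/dπ` is
square-integrable with respect to `π`. -/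
def sqIntegrableLaws (π : Measure X) : Set (Measure X) :=
  {μ | IsProbabilityMeasure μ ∧ μ ≪ π ∧ ∫⁻ x, μ.rnDeriv π x ^ 2 ∂π < ∞}

/-- Real measurable functions with `∫ f² dπ = 1`.  (The Bochner integral of a function that is
not integrable is `0`, so the equation forces `f²` to be integrable.) -/
def unitTestFunctions (π : Measure X) : Set (X → ℝ) :=
  {f | Measurable f ∧ ∫ x, f x ^ 2 ∂π = 1}

/-- The `L²(π)` distance `‖μ - ν‖₂ = sup_f |μ f - ν f|`, over measurable `f` with `∫ f² dπ = 1`,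
as an extended nonnegative number. -/
noncomputable def l2Dist (π μ ν : Measure X) : ℝ≥0∞ :=
  ⨆ f ∈ unitTestFunctions π, ENNReal.ofReal |∫ x, f x ∂μ - ∫ x, f x ∂ν|

/-- `L²₀(π)`: the elements of `L²(π)` with mean zero. -/
def L2zero (π : Measure X) [IsProbabilityMeasure π] : Submodule ℝ (Lp ℝ 2 π) where
  carrier := {f | ∫ x, f x ∂π = 0}
  zero_mem' := by
    simp only [Set.mem_ofPred_eq]
    rw [integral_congr_ae (Lp.coeFn_zero ℝ 2 π)]
    simp
  add_mem' {f g} hf hg := by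
    simp only [Set.mem_ofPred_eq] at *
    rw [integral_congr_ae (Lp.coeFn_add f g)]
    simp only [Pi.add_apply]
    rw [integral_add ((Lp.memLp f).integrable one_le_two)
      ((Lp.memLp g).integrable one_le_two), hf, hg, add_zero]
  smul_mem' c f hf := by
    simp only [Set.mem_ofPred_eq] at *
    rw [integral_congr_ae (Lp.coeFn_smul c f)]
    simp only [Pi.smul_apply]
    rw [integral_smul, hf, smul_zero]

/-- `(K f)(x) = ∫ f(x') K(x, dx')`. -/
noncomputable def act (K : Kernel X X) (f : X → ℝ) : X → ℝ := fun x => ∫ y, f y ∂(K x)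

section

variable {K : Kernel X X} {π : Measure X}

theorem ae_ae_of_invariant (hK : K.Invariant π) {p : X → Prop} (h : ∀ᵐ x ∂π, p x) :
    ∀ᵐ x ∂π, ∀ᵐ y ∂(K x), p y := by
  rw [← hK.def] at h
  exact Measure.ae_ae_of_ae_comp h

theorem act_congr (hK : K.Invariant π) {f g : X → ℝ} (h : f =ᵐ[π] g) :
    act K f =ᵐ[π] act K g := by
  filter_upwards [ae_ae_of_invariant hK h] with x hx
  exact integral_congr_ae hx

theorem ae_integrable (hK : K.Invariant π) {f : X → ℝ} (hf : Integrable f π) :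
    ∀ᵐ x ∂π, Integrable f (K x) := by
  rw [← hK.def] at hf
  exact ((Measure.integrable_comp_iff hf.1).1 hf).1

theorem integral_act (hK : K.Invariant π) {f : X → ℝ} (hf : Integrable f π) :
    ∫ x, act K f x ∂π = ∫ x, f x ∂π := by
  have h : Integrable f (π.bind K) := by rw [hK.def]; exact hf
  rw [Measure.comp_eq_comp_const_apply] at h
  have h2 := Kernel.integral_comp h
  rw [← Measure.comp_eq_comp_const_apply, hK.def] at h2
  simpa [act] using h2.symm

theorem eLpNorm_act_le [IsMarkovKernel K] (hK : K.Invariant π) {f : X → ℝ}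
    (hf : StronglyMeasurable f) : eLpNorm (act K f) 2 π ≤ eLpNorm f 2 π := by
  have key : ∀ x, ‖act K f x‖ₑ ^ (2 : ℝ) ≤ ∫⁻ y, ‖f y‖ₑ ^ (2 : ℝ) ∂(K x) := by
    intro x
    have h1 : ‖act K f x‖ₑ ≤ eLpNorm f 1 (K x) := by
      rw [eLpNorm_one_eq_lintegral_enorm]
      exact enorm_integral_le_lintegral_enorm _
    have h2 : eLpNorm f 1 (K x) ≤ eLpNorm f 2 (K x) :=
      eLpNorm_le_eLpNorm_of_exponent_le one_le_two hf.aestronglyMeasurable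
    calc ‖act K f x‖ₑ ^ (2 : ℝ) ≤ eLpNorm f 2 (K x) ^ (2 : ℝ) := by
          gcongr; exact h1.trans h2
      _ = _ := by
          rw [eLpNorm_eq_lintegral_rpow_enorm_toReal two_ne_zero ENNReal.ofNat_ne_top,
            ← ENNReal.rpow_mul]
          simp
  rw [eLpNorm_eq_lintegral_rpow_enorm_toReal two_ne_zero ENNReal.ofNat_ne_top,
    eLpNorm_eq_lintegral_rpow_enorm_toReal two_ne_zero ENNReal.ofNat_ne_top]
  simp only [ENNReal.toReal_ofNat]
  gcongr ?_ ^ _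
  calc ∫⁻ x, ‖act K f x‖ₑ ^ (2 : ℝ) ∂π ≤ ∫⁻ x, ∫⁻ y, ‖f y‖ₑ ^ (2 : ℝ) ∂(K x) ∂π :=
        lintegral_mono key
    _ = ∫⁻ y, ‖f y‖ₑ ^ (2 : ℝ) ∂(π.bind K) := by
        rw [Measure.lintegral_bind K.aemeasurable (hf.enorm.pow_const _).aemeasurable]
    _ = _ := by rw [hK.def]

theorem memLp_act [IsMarkovKernel K] (hK : K.Invariant π) (f : Lp ℝ 2 π) :
    MemLp (act K f) 2 π :=
  ⟨(Lp.stronglyMeasurable f).integral_kernel.aestronglyMeasurable,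
    (eLpNorm_act_le hK (Lp.stronglyMeasurable f)).trans_lt (Lp.memLp f).eLpNorm_lt_top⟩

end

/-- The Markov operator `f ↦ K f` on `L²₀(π)` of a Markov kernel `K` with stationary law `π`. -/
noncomputable def markovOperator (K : Kernel X X) [IsMarkovKernel K] (π : Measure X)
    [IsProbabilityMeasure π] (hK : K.Invariant π) : L2zero π →L[ℝ] L2zero π :=
  LinearMap.mkContinuous
    { toFun := fun f => ⟨(memLp_act hK (f : Lp ℝ 2 π)).toLp (act K (f : Lp ℝ 2 π)), by
        change ∫ x, (memLp_act hK (f : Lp ℝ 2 π)).toLp (act K (f : Lp ℝ 2 π)) x ∂π = 0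
        rw [integral_congr_ae (MemLp.coeFn_toLp _),
          integral_act hK ((Lp.memLp (f : Lp ℝ 2 π)).integrable one_le_two)]
        exact f.2⟩
      map_add' := fun f g => by
        apply Subtype.ext
        refine MemLp.toLp_congr (memLp_act hK _) ((memLp_act hK _).add (memLp_act hK _)) ?_
        have hf := ae_integrable hK ((Lp.memLp (f : Lp ℝ 2 π)).integrable one_le_two)
        have hg := ae_integrable hK ((Lp.memLp (g : Lp ℝ 2 π)).integrable one_le_two)
        refine (act_congr hK (Lp.coeFn_add (f : Lp ℝ 2 π) (g : Lp ℝ 2 π))).trans ?_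
        filter_upwards [hf, hg] with x h1 h2
        exact integral_add h1 h2
      map_smul' := fun c f => by
        apply Subtype.ext
        refine MemLp.toLp_congr (memLp_act hK _) ((memLp_act hK _).const_smul c) ?_
        refine (act_congr hK (Lp.coeFn_smul c (f : Lp ℝ 2 π))).trans ?_
        filter_upwards with x
        exact integral_smul c _ }
    1 (fun f => by
      rw [one_mul]
      change ‖(memLp_act hK (f : Lp ℝ 2 π)).toLp (act K (f : Lp ℝ 2 π))‖ ≤ ‖(f : Lp ℝ 2 π)‖
      rw [Lp.norm_toLp, Lp.norm_def]
      exact ENNReal.toReal_mono (Lp.memLp (f : Lp ℝ 2 π)).eLpNorm_ne_top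
        (eLpNorm_act_le hK (Lp.stronglyMeasurable (f : Lp ℝ 2 π))))

end MarkovL2

/-! Reversibility makes `K` a symmetric operator `T` on `L²₀(π)`. A unit `f` there is `m` times the
difference of two probability densities in `L²(π)`, so `⟨f, Tᵗ f⟩` is `m` times the difference of
the integrals of `f` under two laws `μKᵗ`, `νKᵗ`. Since `f` is itself an admissible test function,
the hypothesis bounds this by `m (C μ + C ν) ρᵗ` (`exists_laws_integral_sub`). By symmetry `‖Tⁿ f‖²
= ⟨f, T²ⁿ f⟩`, and `n ↦ ‖Tⁿ f‖` is log-convex, so it grows at least like `(‖T f‖ / ‖f‖)ⁿ`. Hence `‖T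
f‖ ≤ ρ ‖f‖` (`norm_apply_le_of_inner_pow_le`). The constant, which depends on `f`, disappears as `n
→ ∞`, so neither uniformity of `C` nor the spectral theorem is needed. -/

namespace MarkovL2

/-! ### Symmetric operators on an inner product space -/

section Hilbert

variable {H : Type*} [NormedAddCommGroup H] [InnerProductSpace ℝ H]

/-- The orbit norms of a symmetric operator are log-convex. -/
theorem norm_pow_succ_sq_le {T : H →L[ℝ] H} (hT : ∀ f g, inner ℝ (T f) g = inner ℝ f (T g))
    (f : H) (n : ℕ) :
    ‖(T ^ (n + 1)) f‖ ^ 2 ≤ ‖(T ^ n) f‖ * ‖(T ^ (n + 2)) f‖ := by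
  have h : inner ℝ ((T ^ (n + 1)) f) ((T ^ (n + 1)) f)
      = inner ℝ ((T ^ n) f) ((T ^ (n + 2)) f) := by
    rw [pow_succ' T (n + 1), mul_apply_eq_comp, ← hT, pow_succ' T n, mul_apply_eq_comp]
  rw [← real_inner_self_eq_norm_sq, h]
  exact real_inner_le_norm _ _

theorem inner_pow_symm {T : H →L[ℝ] H} (hT : ∀ f g, inner ℝ (T f) g = inner ℝ f (T g))
    (n : ℕ) (f g : H) : inner ℝ ((T ^ n) f) g = inner ℝ f ((T ^ n) g) := by
  induction n generalizing f g with
  | zero => simp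
  | succ n ih => rw [pow_succ, mul_apply_eq_comp, ih, hT, ← mul_apply_eq_comp, ← pow_succ',
      pow_succ]

/-- A symmetric operator contracts a vector at least at the geometric rate at which its
autocorrelations decay. -/
theorem norm_apply_le_of_inner_pow_le {T : H →L[ℝ] H}
    (hT : ∀ f g, inner ℝ (T f) g = inner ℝ f (T g)) {f : H} {C ρ : ℝ} (hρ : 0 ≤ ρ)
    (h : ∀ n, |inner ℝ f ((T ^ n) f)| ≤ C * ρ ^ n) : ‖T f‖ ≤ ρ * ‖f‖ := by
  by_contra! hlt
  have hf : 0 < ‖f‖ := by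
    rw [norm_pos_iff]
    rintro rfl
    simp at hlt
  set r := ‖T f‖ / ‖f‖ with hr
  have hρr : ρ < r := by rwa [hr, lt_div_iff₀ hf]
  have hr0 : 0 < r := hρ.trans_lt hρr
  -- By log-convexity the successive ratios of orbit norms never fall below the first one, `r`;
  -- positivity is carried along to allow cancellation.
  have step : ∀ n, 0 < ‖(T ^ n) f‖ ∧ r * ‖(T ^ n) f‖ ≤ ‖(T ^ (n + 1)) f‖ := by
    intro n
    induction n with
    | zero => simpa [hr, hf.ne'] using hf
    | succ n ih =>
      have h1 : 0 < ‖(T ^ (n + 1)) f‖ := (mul_pos hr0 ih.1).trans_le ih.2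
      refine ⟨h1, le_of_mul_le_mul_left ?_ ih.1⟩
      calc ‖(T ^ n) f‖ * (r * ‖(T ^ (n + 1)) f‖)
          = (r * ‖(T ^ n) f‖) * ‖(T ^ (n + 1)) f‖ := by ring
        _ ≤ ‖(T ^ (n + 1)) f‖ * ‖(T ^ (n + 1)) f‖ := by gcongr; exact ih.2
        _ = ‖(T ^ (n + 1)) f‖ ^ 2 := by ring
        _ ≤ _ := norm_pow_succ_sq_le hT f n
  have lower : ∀ n, r ^ n * ‖f‖ ≤ ‖(T ^ n) f‖ := by
    intro n
    induction n with
    | zero => simp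
    | succ n ih =>
      calc r ^ (n + 1) * ‖f‖ = r * (r ^ n * ‖f‖) := by ring
        _ ≤ r * ‖(T ^ n) f‖ := by gcongr
        _ ≤ _ := (step n).2
  -- Symmetry turns `‖Tⁿ f‖²` into the autocorrelation at lag `n + n`; as `ρ < r`, the bound tends
  -- to `0`.
  have upper : ∀ n, ‖f‖ ^ 2 ≤ C * ((ρ / r) ^ 2) ^ n := by
    intro n
    have h1 : ‖(T ^ n) f‖ ^ 2 ≤ C * ρ ^ (n + n) := by
      rw [← real_inner_self_eq_norm_sq, inner_pow_symm hT, ← mul_apply_eq_comp, ← pow_add]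
      exact (le_abs_self _).trans (h _)
    have h2 : (r ^ n * ‖f‖) ^ 2 ≤ C * ρ ^ (n + n) :=
      (pow_le_pow_left₀ (by positivity) (lower n) 2).trans h1
    have h3 : C * ((ρ / r) ^ 2) ^ n = C * ρ ^ (n + n) / (r ^ n) ^ 2 := by
      rw [← pow_mul, div_pow, ← pow_mul, two_mul, mul_two, mul_div_assoc]
    rw [h3, le_div_iff₀ (by positivity)]
    linarith [mul_pow (r ^ n) ‖f‖ 2]
  have hlim : Filter.Tendsto (fun n : ℕ => C * ((ρ / r) ^ 2) ^ n) Filter.atTop (nhds (C * 0)) := by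
    refine (tendsto_pow_atTop_nhds_zero_of_lt_one (by positivity) ?_).const_mul C
    exact pow_lt_one₀ (by positivity) ((div_lt_one hr0).2 hρr) two_ne_zero
  have := ge_of_tendsto' hlim upper
  rw [mul_zero] at this
  exact absurd this (not_le.2 (by positivity))

end Hilbert

variable {X : Type*} [MeasurableSpace X] {K : Kernel X X} {π : Measure X}

/-! ### Reversibility and symmetry of the Markov operator -/

section Reversible

/-- Detailed balance is this symmetry tested on rectangles, which determine the joint law of two
consecutive states. -/
theorem compProd_map_swap_of_isReversible [IsMarkovKernel K] [IsProbabilityMeasure π]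
    (hrev : K.IsReversible π) : (π ⊗ₘ K).map Prod.swap = π ⊗ₘ K := by
  refine Measure.ext_prod fun {s t} hs ht => ?_
  rw [Measure.map_apply measurable_swap (hs.prod ht), Set.preimage_swap_prod,
    Measure.compProd_apply_prod ht hs, Measure.compProd_apply_prod hs ht]
  exact hrev ht hs

/-- Both marginals of `π ⊗ₘ K` are `π`, so the product is integrable by Hölder and Fubini applies.
-/
theorem integral_mul_act_eq_integral_compProd [IsMarkovKernel K] [IsProbabilityMeasure π]
    (hK : K.Invariant π) {f g : X → ℝ} (hf : MemLp f 2 π) (hg : MemLp g 2 π) :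
    ∫ x, f x * act K g x ∂π = ∫ z, f z.1 * g z.2 ∂(π ⊗ₘ K) := by
  have h1 : MemLp (fun z : X × X => f z.1) 2 (π ⊗ₘ K) := by
    refine MemLp.comp_of_map (f := Prod.fst) ?_ measurable_fst.aemeasurable
    change MemLp f 2 (π ⊗ₘ K).fst
    rwa [Measure.fst_compProd]
  have h2 : MemLp (fun z : X × X => g z.2) 2 (π ⊗ₘ K) := by
    refine MemLp.comp_of_map (f := Prod.snd) ?_ measurable_snd.aemeasurable
    change MemLp g 2 (π ⊗ₘ K).snd
    rwa [Measure.snd_compProd, hK.def]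
  have h3 : Integrable (fun z : X × X => f z.1 * g z.2) (π ⊗ₘ K) := h1.integrable_mul h2
  rw [Measure.integral_compProd h3]
  simp only [act, integral_const_mul]

theorem integral_mul_act_comm [IsMarkovKernel K] [IsProbabilityMeasure π]
    (hrev : K.IsReversible π) {f g : X → ℝ} (hf : MemLp f 2 π) (hg : MemLp g 2 π) :
    ∫ x, f x * act K g x ∂π = ∫ x, g x * act K f x ∂π := by
  rw [integral_mul_act_eq_integral_compProd hrev.invariant hf hg,
    integral_mul_act_eq_integral_compProd hrev.invariant hg hf]
  conv_lhs => rw [← compProd_map_swap_of_isReversible hrev]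
  rw [show (Prod.swap : X × X → X × X) = MeasurableEquiv.prodComm from rfl,
    integral_map_equiv]
  exact integral_congr_ae (.of_forall fun z => mul_comm _ _)

theorem coeFn_markovOperator [IsMarkovKernel K] [IsProbabilityMeasure π] (hK : K.Invariant π)
    (f : L2zero π) :
    ((markovOperator K π hK f : Lp ℝ 2 π) : X → ℝ) =ᵐ[π] act K (f : Lp ℝ 2 π) :=
  MemLp.coeFn_toLp (memLp_act hK (f : Lp ℝ 2 π))

theorem L2zero_inner_eq [IsProbabilityMeasure π] (f g : L2zero π) :
    inner ℝ f g = ∫ x, (f : Lp ℝ 2 π) x * (g : Lp ℝ 2 π) x ∂π := by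
  rw [Submodule.coe_inner, L2.inner_def]
  simp [mul_comm]

theorem markovOperator_symm [IsMarkovKernel K] [IsProbabilityMeasure π]
    (hrev : K.IsReversible π) (f g : L2zero π) :
    inner ℝ (markovOperator K π hrev.invariant f) g
      = inner ℝ f (markovOperator K π hrev.invariant g) := by
  rw [real_inner_comm, L2zero_inner_eq, L2zero_inner_eq]
  have h (u v : L2zero π) : ∫ x, (u : Lp ℝ 2 π) x *
      (markovOperator K π hrev.invariant v : Lp ℝ 2 π) x ∂π
        = ∫ x, (u : Lp ℝ 2 π) x * act K (v : Lp ℝ 2 π) x ∂π := by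
    refine integral_congr_ae ?_
    filter_upwards [coeFn_markovOperator hrev.invariant v] with x hx
    rw [hx]
  rw [h, h]
  exact integral_mul_act_comm hrev (Lp.memLp _) (Lp.memLp _)

end Reversible

/-! ### Powers of the kernel and of the operator -/

section Powers

theorem invariant_pow (hK : K.Invariant π) (t : ℕ) : (K ^ t : Kernel X X).Invariant π := by
  induction t with
  | zero =>
    rw [pow_zero]
    exact Measure.id_comp
  | succ t ih =>
    rw [pow_succ]
    exact ih.comp hK

theorem isMarkovKernel_pow [IsMarkovKernel K] (t : ℕ) : IsMarkovKernel (K ^ t : Kernel X X) := by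
  induction t with
  | zero =>
    rw [pow_zero]
    exact inferInstanceAs (IsMarkovKernel (Kernel.id : Kernel X X))
  | succ t ih =>
    rw [pow_succ]
    exact inferInstanceAs (IsMarkovKernel ((K ^ t : Kernel X X) ∘ₖ K))

theorem act_pow_succ (hK : K.Invariant π) {f : X → ℝ}
    (hf : Integrable f π) (t : ℕ) :
    act (K ^ (t + 1) : Kernel X X) f =ᵐ[π] act K (act (K ^ t : Kernel X X) f) := by
  filter_upwards [ae_integrable (invariant_pow hK (t + 1)) hf] with x hx
  rw [pow_succ] at hx
  simp only [act]
  rw [pow_succ]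
  exact Kernel.integral_comp hx

theorem coeFn_markovOperator_pow [IsMarkovKernel K] [IsProbabilityMeasure π]
    (hK : K.Invariant π) (f : L2zero π) (t : ℕ) :
    (((markovOperator K π hK ^ t) f : L2zero π) : Lp ℝ 2 π)
      =ᵐ[π] act (K ^ t : Kernel X X) (f : Lp ℝ 2 π) := by
  induction t with
  | zero =>
    refine .of_forall fun x => ?_
    rw [pow_zero, pow_zero]
    change _ = ∫ y, (f : Lp ℝ 2 π) y ∂(Kernel.id x)
    rw [Kernel.id_apply, integral_dirac' _ _ (Lp.stronglyMeasurable _)]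
    rfl
  | succ t ih =>
    rw [pow_succ', mul_apply_eq_comp]
    exact (coeFn_markovOperator hK _).trans ((act_congr hK ih).trans
      (act_pow_succ hK ((Lp.memLp _).integrable one_le_two) t).symm)

end Powers

/-! ### Laws with square-integrable densities -/

section Densities

variable {g : X → ℝ}

theorem lintegral_ofReal_sq_lt_top (hg : MemLp g 2 π) (hg0 : 0 ≤ g) :
    ∫⁻ x, ENNReal.ofReal (g x) ^ 2 ∂π < ∞ := by
  have h := hg.integrable_sq.lintegral_lt_top
  simpa only [ENNReal.ofReal_pow (hg0 _)] using h

theorem withDensity_mem_sqIntegrableLaws [IsProbabilityMeasure π] (hgm : Measurable g)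
    (hg : MemLp g 2 π) (hg0 : 0 ≤ g) (hg1 : ∫ x, g x ∂π = 1) :
    π.withDensity (fun x => ENNReal.ofReal (g x)) ∈ sqIntegrableLaws π := by
  refine ⟨⟨?_⟩, withDensity_absolutelyContinuous _ _, ?_⟩
  · rw [withDensity_apply _ .univ, Measure.restrict_univ,
      ← ofReal_integral_eq_lintegral_ofReal (hg.integrable one_le_two) (.of_forall hg0), hg1,
      ENNReal.ofReal_one]
  · refine (lintegral_congr_ae ?_).trans_lt (lintegral_ofReal_sq_lt_top hg hg0)
    filter_upwards [Measure.rnDeriv_withDensity π hgm.ennreal_ofReal] with x hx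
    rw [hx]

theorem integral_bind_withDensity [IsMarkovKernel K] [IsProbabilityMeasure π]
    (hK : K.Invariant π) (hgm : Measurable g) (hg : MemLp g 2 π) (hg0 : 0 ≤ g)
    (h : Lp ℝ 2 π) :
    ∫ x, h x ∂((π.withDensity fun x => ENNReal.ofReal (g x)).bind K)
      = ∫ x, g x * act K h x ∂π := by
  set μ := π.withDensity fun x => ENNReal.ofReal (g x) with hμ
  have hlt : ∀ᵐ x ∂π, ENNReal.ofReal (g x) < ∞ := .of_forall fun _ => ENNReal.ofReal_lt_top
  have hac : μ ≪ π := withDensity_absolutelyContinuous _ _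
  have habs : MemLp (act K fun x => ‖h x‖) 2 π :=
    ⟨(Lp.stronglyMeasurable h).norm.integral_kernel.aestronglyMeasurable,
      (eLpNorm_act_le hK (Lp.stronglyMeasurable h).norm).trans_lt
        (Lp.memLp h).norm.eLpNorm_lt_top⟩
  -- `K|h|` and `g` both lie in `L²(π)`, so their product is integrable.
  have hint : Integrable h (μ.bind K) := by
    refine (Measure.integrable_comp_iff (Lp.stronglyMeasurable h).aestronglyMeasurable).2
      ⟨hac (ae_integrable hK ((Lp.memLp h).integrable one_le_two)), ?_⟩
    rw [hμ, integrable_withDensity_iff hgm.ennreal_ofReal hlt]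
    simp only [ENNReal.toReal_ofReal (hg0 _)]
    exact habs.integrable_mul hg
  rw [Measure.comp_eq_comp_const_apply] at hint
  have h2 := Kernel.integral_comp hint
  rw [← Measure.comp_eq_comp_const_apply] at h2
  rw [h2, Kernel.const_apply, hμ,
    integral_withDensity_eq_integral_toReal_smul hgm.ennreal_ofReal hlt]
  simp only [ENNReal.toReal_ofReal (hg0 _), smul_eq_mul]
  rfl

end Densities

theorem abs_integral_sub_le_of_l2Dist_le {μ ν : Measure X} {c : ℝ} (hc : 0 ≤ c)
    (hd : l2Dist π μ ν ≤ ENNReal.ofReal c) {f : X → ℝ} (hf : f ∈ unitTestFunctions π) :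
    |∫ x, f x ∂μ - ∫ x, f x ∂ν| ≤ c := by
  rw [← ENNReal.ofReal_le_ofReal_iff hc]
  exact (le_iSup₂ (f := fun (f : X → ℝ) (_ : f ∈ unitTestFunctions π) =>
    ENNReal.ofReal |∫ x, f x ∂μ - ∫ x, f x ∂ν|) f hf).trans hd

theorem coeFn_mem_unitTestFunctions [IsProbabilityMeasure π] {f : L2zero π} (hf : ‖f‖ = 1) :
    ((f : Lp ℝ 2 π) : X → ℝ) ∈ unitTestFunctions π := by
  refine ⟨(Lp.stronglyMeasurable _).measurable, ?_⟩
  have h : inner ℝ f f = (1 : ℝ) := by rw [real_inner_self_eq_norm_sq, hf, one_pow]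
  rw [L2zero_inner_eq] at h
  simpa only [sq] using h

/-- A nonzero element of `L²₀(π)` is a multiple of the difference of two square-integrable laws, its
normalized positive and negative parts. -/
theorem exists_laws_integral_sub [IsProbabilityMeasure π] {f : L2zero π} (hf : f ≠ 0) :
    ∃ m : ℝ, 0 ≤ m ∧ ∃ μ ν : sqIntegrableLaws π, ∀ (L : Kernel X X) [IsMarkovKernel L],
      L.Invariant π → ∀ h : Lp ℝ 2 π,
        ∫ x, (f : Lp ℝ 2 π) x * act L h x ∂π
          = m * (∫ x, h x ∂((μ : Measure X).bind L) - ∫ x, h x ∂((ν : Measure X).bind L)) := by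
  have hfm : Measurable (f : Lp ℝ 2 π) := (Lp.stronglyMeasurable _).measurable
  have hfL : MemLp (f : Lp ℝ 2 π) 2 π := Lp.memLp _
  have hpL : MemLp (fun x => max ((f : Lp ℝ 2 π) x) 0) 2 π := hfL.pos_part
  have hnL : MemLp (fun x => max (-(f : Lp ℝ 2 π) x) 0) 2 π := hfL.neg_part
  have hsub (x : X) : max ((f : Lp ℝ 2 π) x) 0 - max (-(f : Lp ℝ 2 π) x) 0 = (f : Lp ℝ 2 π) x := by
    rcases le_total 0 ((f : Lp ℝ 2 π) x) with hx | hx <;> simp [hx]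
  set m := ∫ x, max ((f : Lp ℝ 2 π) x) 0 ∂π with hm
  -- Mean zero gives the positive and negative parts the same mass, so one factor normalizes both.
  have hmn : ∫ x, max (-(f : Lp ℝ 2 π) x) 0 ∂π = m := by
    have h0 : ∫ x, (f : Lp ℝ 2 π) x ∂π = 0 := f.2
    have h1 := integral_sub (hpL.integrable one_le_two) (hnL.integrable one_le_two)
    simp only [hsub] at h1
    linarith
  have hm0 : 0 ≤ m := integral_nonneg fun x => le_max_right _ _
  have hmpos : 0 < m := by
    refine hm0.lt_of_ne fun h => hf ?_
    have hp := (integral_eq_zero_iff_of_nonneg (fun x => le_max_right _ _)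
      (hpL.integrable one_le_two)).1 (hm ▸ h.symm)
    have hn := (integral_eq_zero_iff_of_nonneg (fun x => le_max_right _ _)
      (hnL.integrable one_le_two)).1 (hmn.trans h.symm)
    apply Subtype.ext
    rw [ZeroMemClass.coe_zero, Lp.eq_zero_iff_ae_eq_zero]
    filter_upwards [hp, hn] with x h1 h2
    rw [← hsub x]
    simp only [Pi.zero_apply] at h1 h2 ⊢
    rw [h1, h2, sub_zero]
  have law {g : X → ℝ} (hgL : MemLp g 2 π) (hg1 : ∫ x, g x ∂π = m) :
      MemLp (fun x => m⁻¹ * g x) 2 π ∧ ∫ x, m⁻¹ * g x ∂π = 1 :=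
    ⟨hgL.const_mul _, by rw [integral_const_mul, hg1, inv_mul_cancel₀ hmpos.ne']⟩
  obtain ⟨hpL', hp1⟩ := law hpL rfl
  obtain ⟨hnL', hn1⟩ := law hnL hmn
  have hpm : Measurable fun x => m⁻¹ * max ((f : Lp ℝ 2 π) x) 0 :=
    (hfm.max measurable_const).const_mul _
  have hnm : Measurable fun x => m⁻¹ * max (-(f : Lp ℝ 2 π) x) 0 :=
    (hfm.neg.max measurable_const).const_mul _
  have hp0 : 0 ≤ fun x => m⁻¹ * max ((f : Lp ℝ 2 π) x) 0 := fun x =>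
    mul_nonneg (inv_nonneg.2 hm0) (le_max_right _ _)
  have hn0 : 0 ≤ fun x => m⁻¹ * max (-(f : Lp ℝ 2 π) x) 0 := fun x =>
    mul_nonneg (inv_nonneg.2 hm0) (le_max_right _ _)
  refine ⟨m, hm0, ⟨_, withDensity_mem_sqIntegrableLaws hpm hpL' hp0 hp1⟩,
    ⟨_, withDensity_mem_sqIntegrableLaws hnm hnL' hn0 hn1⟩, fun L _ hL h => ?_⟩
  have hpi : Integrable (fun x => m⁻¹ * max ((f : Lp ℝ 2 π) x) 0 * act L h x) π :=
    hpL'.integrable_mul (memLp_act hL h)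
  have hni : Integrable (fun x => m⁻¹ * max (-(f : Lp ℝ 2 π) x) 0 * act L h x) π :=
    hnL'.integrable_mul (memLp_act hL h)
  rw [integral_bind_withDensity hL hpm hpL' hp0, integral_bind_withDensity hL hnm hnL' hn0,
    ← integral_sub hpi hni, ← integral_const_mul]
  refine integral_congr_ae (.of_forall fun x => ?_)
  simp only
  rw [← sub_mul, ← mul_sub, hsub, ← mul_assoc, mul_inv_cancel_left₀ hmpos.ne']

end MarkovL2

theorem mainTheorem7 {X : Type*} [TopologicalSpace X] [PolishSpace X] [MeasurableSpace X]
    [BorelSpace X] (K : Kernel X X) [IsMarkovKernel K] (π : Measure X) [IsProbabilityMeasure π]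
    (hrev : K.IsReversible π)
    (C : MarkovL2.sqIntegrableLaws π → ℝ≥0) (ρ : ℝ) (hρ₀ : 0 ≤ ρ) (hρ₁ : ρ < 1)
    (hconv : ∀ (μ : MarkovL2.sqIntegrableLaws π) (t : ℕ),
      MarkovL2.l2Dist π ((μ : Measure X).bind (K ^ t : Kernel X X)) π
        ≤ ENNReal.ofReal (C μ * ρ ^ t)) :
    ‖MarkovL2.markovOperator K π hrev.invariant‖ ≤ ρ := by
  refine ContinuousLinearMap.opNorm_le_of_unit_norm hρ₀ fun f hf => ?_
  -- These depend on `f` alone, so one constant serves every `t`.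
  obtain ⟨m, hm, μ, ν, hμν⟩ := MarkovL2.exists_laws_integral_sub
    (f := f) (by rintro rfl; simp at hf)
  have hbound (η : MarkovL2.sqIntegrableLaws π) (t : ℕ) :=
    MarkovL2.abs_integral_sub_le_of_l2Dist_le (by positivity) (hconv η t)
      (MarkovL2.coeFn_mem_unitTestFunctions hf)
  refine (MarkovL2.norm_apply_le_of_inner_pow_le (MarkovL2.markovOperator_symm hrev)
    (C := m * (C μ + C ν)) hρ₀ fun t => ?_).trans_eq (by rw [hf, mul_one])
  have := MarkovL2.isMarkovKernel_pow (K := K) t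
  rw [MarkovL2.L2zero_inner_eq, integral_congr_ae
    ((MarkovL2.coeFn_markovOperator_pow hrev.invariant f t).mono fun x hx => by
      rw [hx]), hμν _ (MarkovL2.invariant_pow hrev.invariant t), abs_mul, abs_of_nonneg hm,
    mul_assoc]
  gcongr
  -- Both laws are compared with their common limit `π`.
  calc _ ≤ _ := abs_sub_le _ (∫ x, (f : Lp ℝ 2 π) x ∂π) _
    _ ≤ C μ * ρ ^ t + C ν * ρ ^ t := by
        rw [abs_sub_comm (∫ x, (f : Lp ℝ 2 π) x ∂π)]
        exact add_le_add (hbound μ t) (hbound ν t)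
    _ = _ := by ring
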